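/- Let $\mathbb{A}=(a_{ij})_{i,j\in I}$ be a symmetrizable generalized Cartan matrix with finite index set $I$, and let $\mathcal{D}=(I,\mathbb{A},\Lambda,(\alpha_i)_{i\in I},(\alpha_i^\vee)_{i\in I})$ be a free and cofree Kac–Moody root datum: $\Lambda$ is a free $\mathbb{Z}$-module of finite rank, the $\alpha_i\in\Lambda$ are linearly independent, the $\alpha_i^\vee\in\Lambda^\vee=\operatorname{Hom}(\Lambda,\mathbb{Z})$ are linearly independent, and $\langle\alpha_j,\alpha_i^\vee\rangle=a_{ij}$ for all $i,j\in I$. Put $\mathfrak{a}=\Lambda^\vee\otimes_{\mathbb{Z}}\mathbb{R}$. Let $W$ be the Weyl group of $\mathbb{A}$, i.e. the Coxeter group with generators $s_i$ $(i\in I)$ and relations $(s_is_j)^{m_{ij}}=1$, where $m_{ii}=1$ and, for $i\ne j$, $m_{ij}=2,3,4,6,\infty$ according to $a_{ij}a_{ji}=0,1,2,3,\ge 4$; it acts linearly on $\mathfrak{a}$ by $s_i(x)=x-\langle\alpha_i,x\rangle\alpha_i^\vee$. Extend $(\alpha_i^\vee)_{i\in I}$ to an $\mathbb{R}$-basis of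 $\mathfrak{a}$ and let $\omega_i\in\mathfrak{a}^*$ $(i\in I)$ be the element of the dual basis corresponding to $\alpha_i^\vee$. Let $h\in\mathfrak{a}$ satisfy $\langle\alpha_k,h\rangle>0$ for all $k\in I$, and set $\Xi_h=\operatorname{conv}(W\cdot h)$ and $E_h=h+\sum_{k\in I}\mathbb{R}\alpha_k^\vee$. Fix $i\in I$ and $t\in\mathbb{R}$, and put $$H^{(i)}(t)=\{y\in E_h:\langle\omega_i,y\rangle=t\},\qquad P^{(i)}(t)=\Xi_h\cap H^{(i)}(t).$$ Let $W^{(i)}\subset W$ be the subgroup generated by the $s_k$ with $k\in I\setminus\{i\}$, and let $C^{(i)}=\{y\in\mathfrak{a}:\langle\alpha_k,y\rangle>0\text{ for all }k\in I\setminus\{i\}\}$. A face of a convex set $P$ is a non-empty convex subset $F\subset P$ such that $p_1,p_2\in F$ whenever $p_1,p_2\in P$ and the open segment $(p_1,p_2)$ meets $F$. Let the essential part $P^{(i)}_{\mathrm{ess}}(t)$ be the union of all faces of $P^{(i)}(t)$ that are contained in $C^{(i)}$. Then every point of $P^{(i)}(t)$ lies in the convex hull of the $W^{(i)}$-orbit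 of a point of $P^{(i)}_{\mathrm{ess}}(t)$; more precisely, $$P^{(i)}(t)=\bigcup_{y\in P^{(i)}_{\mathrm{ess}}(t)}\operatorname{conv}\bigl(W^{(i)}\cdot y\bigr).$$ -/

import Mathlib

open scoped TensorProduct

/-- A generalized Cartan matrix. -/
structure IsGCM {ι : Type*} (A : Matrix ι ι ℤ) : Prop where
  diag : ∀ i, A i i = 2
  off_diag : ∀ i j, i ≠ j → A i j ≤ 0
  zero_iff : ∀ i j, A i j = 0 ↔ A j i = 0

/-- `A` is symmetrizable if it is the product of a diagonal matrix and a symmetric matrix. -/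
def IsSymmetrizable {ι : Type*} [Fintype ι] [DecidableEq ι] (A : Matrix ι ι ℤ) : Prop :=
  ∃ (d : ι → ℝ) (B : Matrix ι ι ℝ), B.IsSymm ∧
    A.map (fun z : ℤ => (z : ℝ)) = Matrix.diagonal d * B

/-- A Kac-Moody root datum with index set `ι` and lattice `Λ`: a generalized Cartan matrix `A`, a
family `c i` in `Λ` and a family `d i` in the dual of `Λ` with `⟨c j, d i⟩ = A i j`. -/
structure KacMoodyRootDatum (ι Λ : Type*) [AddCommGroup Λ] where
  A : Matrix ι ι ℤ
  isGCM : IsGCM A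
  c : ι → Λ
  d : ι → Module.Dual ℤ Λ
  pairing : ∀ i j, d i (c j) = A i j

/-- The real Cartan subalgebra, i.e. the dual lattice of `Λ` with scalars extended to `ℝ`. -/
abbrev RealCartan (Λ : Type*) [AddCommGroup Λ] : Type _ := ℝ ⊗[ℤ] Module.Dual ℤ Λ

/-- The order `m_ij` of a product of two distinct simple reflections as a function of
`a_ij * a_ji`; the value `0` stands for an infinite order. -/
def coxeterOrder (z : ℤ) : ℕ :=
  if z = 0 then 2 else if z = 1 then 3 else if z = 2 then 4 else if z = 3 then 6 else 0

namespace KacMoodyRootDatum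

variable {ι Λ : Type*} [AddCommGroup Λ] (D : KacMoodyRootDatum ι Λ)

/-- The root datum is free if the elements `c i` of `Λ` are linearly independent. -/
def IsFree : Prop := LinearIndependent ℤ D.c

/-- The root datum is cofree if the elements `d i` of the dual of `Λ` are linearly independent. -/
def IsCofree : Prop := LinearIndependent ℤ D.d

/-- The simple root `α_i` as a linear functional on the real Cartan subalgebra. -/
noncomputable def root (i : ι) : Module.Dual ℝ (RealCartan Λ) :=
  LinearMap.liftBaseChange ℝ
    ((Algebra.linearMap ℤ ℝ).comp (Module.Dual.eval ℤ Λ (D.c i)))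

/-- The simple coroot `α_i^∨` as an element of the real Cartan subalgebra. -/
noncomputable def coroot (i : ι) : RealCartan Λ := (1 : ℝ) ⊗ₜ[ℤ] D.d i

theorem root_coroot (i j : ι) : D.root j (D.coroot i) = (D.A i j : ℝ) := by
  simp [root, coroot, D.pairing]

theorem root_coroot_self (i : ι) : D.root i (D.coroot i) = 2 := by
  simp [D.root_coroot, D.isGCM.diag]

open Classical in
/-- The Coxeter matrix of the Weyl group. -/
noncomputable def coxeterMatrix : CoxeterMatrix ι where
  M := fun i j => if i = j then 1 else coxeterOrder (D.A i j * D.A j i)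
  isSymm := Matrix.IsSymm.ext fun i j => by
    rw [mul_comm (D.A j i)]
    simp only [eq_comm (a := j)]
  diagonal := fun i => by simp
  off_diagonal := fun i j hij => by
    simp only [if_neg hij, coxeterOrder]
    split_ifs <;> norm_num

/-- The Weyl group, defined by its Coxeter presentation. -/
abbrev WeylGroup : Type _ := D.coxeterMatrix.Group

/-- The simple reflection `h ↦ h - ⟨α_i, h⟩ α_i^∨` of the real Cartan subalgebra. -/
noncomputable def simpleReflection (i : ι) : RealCartan Λ ≃ₗ[ℝ] RealCartan Λ :=
  Module.reflection (D.root_coroot_self i)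

theorem simpleReflection_liftable : D.coxeterMatrix.IsLiftable D.simpleReflection := by
  intro i j
  by_cases hij : i = j
  · subst hij
    rw [D.coxeterMatrix.diagonal, pow_one]
    ext z
    exact Module.involutive_reflection (D.root_coroot_self i) z
  · have hM : D.coxeterMatrix.M i j = coxeterOrder (D.A i j * D.A j i) := by
      simp [coxeterMatrix, hij]
    rw [hM]
    have key : ∀ p : ℤ, D.A i j * D.A j i = p →
        D.root i (D.coroot j) * D.root j (D.coroot i) - 2 = (p : ℝ) - 2 := by
      intro p hp
      rw [D.root_coroot, D.root_coroot, ← hp]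
      push_cast
      ring
    unfold coxeterOrder simpleReflection
    split_ifs with h0 h1 h2 h3
    · have hA : D.A i j = 0 ∧ D.A j i = 0 := by
        rcases mul_eq_zero.mp h0 with h | h
        · exact ⟨h, (D.isGCM.zero_iff i j).mp h⟩
        · exact ⟨(D.isGCM.zero_iff i j).mpr h, h⟩
      have e1 : D.root i (D.coroot j) = 0 := by simp [D.root_coroot, hA.2]
      have e2 : D.root j (D.coroot i) = 0 := by simp [D.root_coroot, hA.1]
      ext z
      rw [Module.reflection_mul_reflection_pow_apply _ _ 2 z _ (key 0 h0).symm]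
      norm_num [e1, e2]
      module
    · ext z
      rw [Module.reflection_mul_reflection_pow_apply _ _ 3 z _ (key 1 h1).symm]
      norm_num [Polynomial.Chebyshev.S_two]
    · ext z
      rw [Module.reflection_mul_reflection_pow_apply _ _ 4 z _ (key 2 h2).symm]
      norm_num [Polynomial.Chebyshev.S_two]
    · ext z
      rw [Module.reflection_mul_reflection_pow_apply _ _ 6 z _ (key 3 h3).symm]
      norm_num [Polynomial.Chebyshev.S_two]
    · exact pow_zero _

/-- The action of the Weyl group on the real Cartan subalgebra. -/
noncomputable def weylAction : D.WeylGroup →* (RealCartan Λ ≃ₗ[ℝ] RealCartan Λ) :=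
  D.coxeterMatrix.toCoxeterSystem.lift ⟨D.simpleReflection, D.simpleReflection_liftable⟩

/-- The standard subgroup `W_J` generated by the simple reflections `s_j` with `j ∈ J`. -/
noncomputable def standardSubgroup (J : Set ι) : Subgroup D.WeylGroup :=
  Subgroup.closure (D.coxeterMatrix.simple '' J)

/-- The orbit of the point `y` under the standard subgroup `W_J`. -/
def orbit (J : Set ι) (y : RealCartan Λ) : Set (RealCartan Λ) :=
  {z | ∃ w ∈ D.standardSubgroup J, z = D.weylAction w y}

/-- The open fundamental chamber of the standard subgroup `W_J`. -/
def openChamber (J : Set ι) : Set (RealCartan Λ) :=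
  {y | ∀ k ∈ J, 0 < D.root k y}

/-- The convex hull `Ξ_h` of the Weyl group orbit of `h`. -/
def orbitHull (h : RealCartan Λ) : Set (RealCartan Λ) :=
  convexHull ℝ {z | ∃ w : D.WeylGroup, z = D.weylAction w h}

/-- The affine space `E_h = h + span {α_i^∨}`. -/
def orbitSpace (h : RealCartan Λ) : Set (RealCartan Λ) :=
  {y | y - h ∈ Submodule.span ℝ (Set.range D.coroot)}

/-- The level set `{y ∈ E_h | ω y = t}` of a linear functional `ω`. -/
def levelPlane (h : RealCartan Λ) (ω : Module.Dual ℝ (RealCartan Λ)) (t : ℝ) :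
    Set (RealCartan Λ) :=
  {y | y ∈ D.orbitSpace h ∧ ω y = t}

/-- The slice of `Ξ_h` by the level set of `ω` at height `t`. -/
def slice (h : RealCartan Λ) (ω : Module.Dual ℝ (RealCartan Λ)) (t : ℝ) :
    Set (RealCartan Λ) :=
  D.orbitHull h ∩ D.levelPlane h ω t

end KacMoodyRootDatum

/-- A face of a convex set `P`: a non-empty convex subset `F` of `P` such that every segment in `P`
whose relative interior meets `F` is contained in `F`. -/
def IsFace {V : Type*} [AddCommGroup V] [Module ℝ V] (P F : Set V) : Prop :=
  F.Nonempty ∧ Convex ℝ F ∧ IsExtreme ℝ P F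

/-- The essential part of a convex set `P` with respect to the standard subgroup `W_J`: the union
of all faces of `P` that are contained in the open fundamental chamber of `W_J`. -/
def KacMoodyRootDatum.essentialPart {ι Λ : Type*} [AddCommGroup Λ] (D : KacMoodyRootDatum ι Λ)
    (J : Set ι) (P : Set (RealCartan Λ)) : Set (RealCartan Λ) :=
  {y | ∃ F : Set (RealCartan Λ), IsFace P F ∧ F ⊆ D.openChamber J ∧ y ∈ F}

/-!
The convex hull of the orbit of a strictly dominant `h` is governed by the dominance order, in which
`x ≤ y` means that `y - x` is a non-negative combination of simple coroots. All of `conv (W h)` lies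
below `h`, because `w⁻¹ α_k` is a positive root whenever `s_k w` is longer than `w`. Conversely, a
strictly dominant `z ≤ h` lies in `conv (W h)`: divide the segment from `h` to `z` into steps so
short that each of them stays in the convex hull of a point and its simple reflections. If `z` is
only dominant but the orbit of `h` under the stabilizer of `z` is finite with barycentre `a`, this
applies to `z + ε (h - a)`, whose orbit hull under the stabilizer contains `z`.

The hull is closed above every height. By Carathéodory's theorem some `w h` has mass bounded below
in a representation of a given point `x`, so the heights of the points `v x` and `v w h` are
comparable for all `v`, and only finitely many `w` arise. Conversely, these comparisons and the
inequalities `v x ≤ h` for all `v` are closed conditions on `x`, under which the orbit of `x`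
contains a dominant point below `h` of the finite kind just treated.

Let `≤` now denote the dominance order of `W_J`, and let `P` be the slice. Every point of `P` lies
below a point of `P` in the open chamber of `W_J`, so maximal points of `P` lie in this chamber. The
maximal points form an extreme subset of `P`, so the smallest face containing a maximal point lies
in the chamber and maximal points are essential. Given `x ∈ P`, choose a chamber point `p ∈ P` with
`x ∈ conv (W_J p)` and, by compactness, a maximal `y ≥ p`; then `p`, and with it `x`, lies in
`conv (W_J y)`.
-/

open Module (finrank)
open CoxeterSystem (alternatingWord alternatingWord_succ)

section Convexity

variable {V : Type*} [AddCommGroup V] [Module ℝ V] {P : Set V} {y : V}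

/-- The smallest face of the convex set `P` that contains its point `y`: the points `z` of `P` for
which the segment from `z` to `y` can be prolonged beyond `y` within `P`. -/
def minimalFace (P : Set V) (y : V) : Set V :=
  {z ∈ P | ∃ ε > (0 : ℝ), y + ε • (y - z) ∈ P}

theorem mem_minimalFace_self (hy : y ∈ P) : y ∈ minimalFace P y :=
  ⟨hy, 1, one_pos, by simpa using hy⟩

theorem minimalFace_subset_of_isExtreme {F : Set V} (hF : IsExtreme ℝ P F) (hy : y ∈ F) :
    minimalFace P y ⊆ F := by
  rintro z ⟨hz, ε, hε, hzε⟩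
  refine hF.left_mem_of_mem_openSegment hz hzε hy
    ⟨ε / (1 + ε), 1 / (1 + ε), by positivity, by positivity, by field_simp; ring, ?_⟩
  match_scalars <;> field_simp
  ring

theorem convex_minimalFace (hP : Convex ℝ P) (hy : y ∈ P) : Convex ℝ (minimalFace P y) := by
  have shrink {z : V} {δ ε : ℝ} (hδ : 0 < δ) (hle : δ ≤ ε) (hz : y + ε • (y - z) ∈ P) :
      y + δ • (y - z) ∈ P := by
    have hε := hδ.trans_le hle
    convert hP.add_smul_sub_mem hy hz ⟨(div_pos hδ hε).le, (div_le_one hε).2 hle⟩ using 1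
    match_scalars <;> field_simp
    ring
  rintro z₁ ⟨hz₁, ε₁, hε₁, h₁⟩ z₂ ⟨hz₂, ε₂, hε₂, h₂⟩ a b ha hb hab
  have hε : 0 < min ε₁ ε₂ := lt_min hε₁ hε₂
  refine ⟨hP hz₁ hz₂ ha hb hab, min ε₁ ε₂, hε, ?_⟩
  convert hP (shrink hε (min_le_left _ _) h₁) (shrink hε (min_le_right _ _) h₂) ha hb hab using 1
  match_scalars
  · linear_combination (-1 - min ε₁ ε₂) * hab
  · ring
  · ring

theorem isExtreme_minimalFace (hP : Convex ℝ P) : IsExtreme ℝ P (minimalFace P y) := by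
  refine ⟨fun _ hz => hz.1, ?_⟩
  rintro x₁ hx₁ x₂ hx₂ _ ⟨-, ε, hε, hzε⟩ ⟨a, b, ha, hb, hab, rfl⟩
  -- mixing in `x₂` cancels its contribution to the prolongation of `a • x₁ + b • x₂` beyond `y`
  refine ⟨hx₁, ε * a / (1 + ε * b), by positivity, ?_⟩
  convert hP hzε hx₂ (a := 1 / (1 + ε * b)) (b := ε * b / (1 + ε * b)) (by positivity)
    (by positivity) (by field_simp) using 1
  match_scalars
  · field_simp
    linear_combination ε * hab
  · field_simp
  · field_simp
    ring

theorem isFace_minimalFace (hP : Convex ℝ P) (hy : y ∈ P) : IsFace P (minimalFace P y) :=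
  ⟨⟨y, mem_minimalFace_self hy⟩, convex_minimalFace hP hy, isExtreme_minimalFace hP⟩

/-- The points of `P` that are maximal with respect to the preorder `x ≤ y ↔ y - x ∈ C` defined by
the cone `C`. -/
def maximalPoints (C : PointedCone ℝ V) (P : Set V) : Set V :=
  {y ∈ P | ∀ z ∈ P, z - y ∈ C → z = y}

theorem isExtreme_maximalPoints (hP : Convex ℝ P) (C : PointedCone ℝ V) :
    IsExtreme ℝ P (maximalPoints C P) := by
  refine ⟨fun _ hy => hy.1, ?_⟩
  rintro x₁ hx₁ x₂ hx₂ _ ⟨-, hmax⟩ ⟨a, b, ha, hb, hab, rfl⟩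
  refine ⟨hx₁, fun z hz hzx => ?_⟩
  have heq := hmax (a • z + b • x₂) (hP hz hx₂ ha.le hb.le hab)
    (by simpa [← smul_sub] using C.smul_mem ha.le hzx)
  exact smul_right_injective V ha.ne' (add_right_cancel heq)

-- In a Carathéodory representation some point carries weight at least `1 / (finrank + 1)`.
theorem exists_mem_sub_apply_le_of_mem_convexHull {s : Set V} [FiniteDimensional ℝ (vectorSpan ℝ s)]
    {x : V} (hx : x ∈ convexHull ℝ s) :
    ∃ p ∈ s, ∀ (g : V →ₗ[ℝ] ℝ) (c : ℝ), (∀ q ∈ s, g q ≤ c) →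
      c - g p ≤ (finrank ℝ (vectorSpan ℝ s) + 1) * (c - g x) := by
  obtain ⟨κ, _, z, w, hzs, hz, hw, hw1, rfl⟩ := eq_pos_convex_span_of_mem_convexHull hx
  have hcard : (Fintype.card κ : ℝ) ≤ finrank ℝ (vectorSpan ℝ s) + 1 := by
    exact_mod_cast hz.card_le_finrank_succ.trans
      (Nat.succ_le_succ (Submodule.finrank_mono (vectorSpan_mono ℝ hzs)))
  have : Nonempty κ := not_isEmpty_iff.1 fun _ => by simp at hw1
  obtain ⟨i, -, hi⟩ : ∃ i ∈ Finset.univ, 1 / (Fintype.card κ : ℝ) ≤ w i :=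
    Finset.exists_le_of_sum_le Finset.univ_nonempty (by simp [hw1])
  have hi : 1 ≤ (finrank ℝ (vectorSpan ℝ s) + 1) * w i := by
    rw [div_le_iff₀' (by positivity)] at hi
    exact hi.trans (mul_le_mul_of_nonneg_right hcard (hw i).le)
  refine ⟨z i, hzs ⟨i, rfl⟩, fun g c hc => ?_⟩
  have hpos (j : κ) : 0 ≤ c - g (z j) := sub_nonneg.2 (hc _ (hzs ⟨j, rfl⟩))
  calc c - g (z i) ≤ (finrank ℝ (vectorSpan ℝ s) + 1) * w i * (c - g (z i)) :=
        le_mul_of_one_le_left (hpos i) hi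
    _ ≤ (finrank ℝ (vectorSpan ℝ s) + 1) * ∑ j, w j * (c - g (z j)) := by
        rw [mul_assoc]
        gcongr
        exact Finset.single_le_sum (f := fun j => w j * (c - g (z j)))
          (fun j _ => mul_nonneg (hw j).le (hpos j)) (Finset.mem_univ i)
    _ = (finrank ℝ (vectorSpan ℝ s) + 1) * (c - g (∑ j, w j • z j)) := by
        simp [mul_sub, Finset.sum_sub_distrib, ← Finset.sum_mul, hw1]

end Convexity

theorem exists_linearMap_apply_eq_single {K V ι : Type*} [Field K] [AddCommGroup V] [Module K V]
    [Finite ι] [DecidableEq ι] {v : ι → V} (hv : LinearIndependent K v) :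
    ∃ C : V →ₗ[K] ι → K, ∀ k, C (v k) = Pi.single k 1 := by
  have := Fintype.ofFinite ι
  obtain ⟨C, hC⟩ := (Fintype.linearCombination K v).exists_leftInverse_of_injective
    (LinearMap.ker_eq_bot.2 (linearIndependent_iff_injective_fintypeLinearCombination.1 hv))
  refine ⟨C, fun k => ?_⟩
  simpa using LinearMap.congr_fun hC (Pi.single k 1)

section Coxeter

variable {B W : Type*} [Group W] {M : CoxeterMatrix B}

theorem leftDescent_induction (cs : CoxeterSystem M W) {p : W → Prop} (one : p 1)
    (simple_mul : ∀ (i : B) (w : W), ¬ cs.IsLeftDescent w i → p w → p (cs.simple i * w)) (w : W) :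
    p w := by
  induction hl : cs.length w using Nat.strong_induction_on generalizing w with
  | _ l ih =>
  obtain rfl | hw := eq_or_ne w 1
  · exact one
  · obtain ⟨i, hi⟩ := cs.exists_leftDescent_of_ne_one hw
    simpa using
      simple_mul i _ (cs.isLeftDescent_iff_not_isLeftDescent_mul.1 hi) (ih _ (hl ▸ hi) _ rfl)

theorem finite_setOf_length_le [Finite B] (cs : CoxeterSystem M W) (n : ℕ) :
    {w | cs.length w ≤ n}.Finite := by
  refine ((List.finite_length_le B n).image cs.wordProd).subset fun w hw => ?_
  obtain ⟨l, hl, rfl⟩ := cs.exists_isReduced w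
  exact ⟨l, hl.eq.symm.trans_le hw, rfl⟩

theorem inv_wordProd_alternatingWord_succ (cs : CoxeterSystem M W) (s t : B) (n : ℕ) :
    (cs.wordProd (alternatingWord s t (n + 1)))⁻¹ =
      cs.simple t * (cs.wordProd (alternatingWord t s n))⁻¹ := by
  rw [alternatingWord_succ, List.concat_eq_append, cs.wordProd_append, cs.wordProd_singleton,
    mul_inv_rev, cs.inv_simple]

theorem exists_eq_inv_wordProd_alternatingWord_mul (cs : CoxeterSystem M W) {w : W} {s : B} (t : B)
    (hs : ¬ cs.IsLeftDescent w s) :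
    ∃ (n : ℕ) (v : W), w = (cs.wordProd (alternatingWord s t n))⁻¹ * v ∧
      cs.length w = n + cs.length v ∧ ¬ cs.IsLeftDescent v s ∧ ¬ cs.IsLeftDescent v t := by
  induction hl : cs.length w using Nat.strong_induction_on generalizing w s t with
  | _ l ih =>
  by_cases ht : cs.IsLeftDescent w t
  · have hlen := cs.isLeftDescent_iff.1 ht
    obtain ⟨n, v, hw, hv, ht', hs'⟩ := ih _ (by lia) (w := cs.simple t * w) s
      (cs.isLeftDescent_iff_not_isLeftDescent_mul.1 ht) rfl
    refine ⟨n + 1, v, ?_, by lia, hs', ht'⟩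
    rw [inv_wordProd_alternatingWord_succ, mul_assoc, ← hw, cs.simple_mul_simple_cancel_left]
  · exact ⟨0, w, by simp [alternatingWord], by simp [hl], hs, ht⟩

theorem lt_of_wordProd_alternatingWord_mul (cs : CoxeterSystem M W) {w v : W} {s t : B} {n : ℕ}
    (hs : ¬ cs.IsLeftDescent w s) (hw : w = (cs.wordProd (alternatingWord s t n))⁻¹ * v)
    (hlen : cs.length w = n + cs.length v) (hM : M s t ≠ 0) : n < M s t := by
  by_contra! hn
  refine cs.not_isReduced_alternatingWord t s (m := n + 1) (by rwa [M.symmetric])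
    (by rw [M.symmetric]; lia) ?_
  have hsw : cs.simple s * w = (cs.wordProd (alternatingWord t s (n + 1)))⁻¹ * v := by
    rw [inv_wordProd_alternatingWord_succ, mul_assoc, ← hw]
  have h₁ := cs.not_isLeftDescent_iff.1 hs
  have h₂ := cs.length_mul_le (cs.wordProd (alternatingWord t s (n + 1)))⁻¹ v
  have h₃ := cs.length_wordProd_le (alternatingWord t s (n + 1))
  rw [← hsw, cs.length_inv] at h₂
  rw [CoxeterSystem.length_alternatingWord] at h₃
  rw [CoxeterSystem.IsReduced, CoxeterSystem.length_alternatingWord]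
  lia

end Coxeter

/-- The coefficients by which the elements of a rank two Weyl group express the images of the simple
roots through the simple roots, where `-a` and `-b` are the off-diagonal entries of the Cartan
matrix. The roles of `a` and `b` are exchanged at every step of the recursion. -/
def dihedralCoeff (a b : ℤ) : ℕ → ℤ
  | 0 => 0
  | 1 => 1
  | n + 2 => a * dihedralCoeff b a (n + 1) - dihedralCoeff a b n

theorem dihedralCoeff_growth {a b : ℤ} (ha : 0 ≤ a) (hb : 0 ≤ b) (hab : 4 ≤ a * b) (n : ℕ) :
    0 ≤ dihedralCoeff a b n ∧ 1 ≤ dihedralCoeff a b (n + 1) ∧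
      2 * dihedralCoeff a b n ≤ a * dihedralCoeff b a (n + 1) := by
  induction n generalizing a b with
  | zero => simpa [dihedralCoeff]
  | succ n ih =>
    obtain ⟨-, h₁, h₂⟩ := ih ha hb hab
    obtain ⟨-, h₁', h₂'⟩ := ih hb ha (by linarith)
    have ha' : 1 ≤ a := by by_contra!; nlinarith
    rw [dihedralCoeff, dihedralCoeff]
    refine ⟨by linarith, by nlinarith, ?_⟩
    nlinarith [mul_le_mul_of_nonneg_left h₂' ha,
      mul_le_mul_of_nonneg_right hab (zero_le_one.trans h₁)]

theorem dihedralCoeff_nonneg {a b : ℤ} (ha : 0 ≤ a) (hb : 0 ≤ b) (h0 : a = 0 ↔ b = 0) {n : ℕ}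
    (hn : coxeterOrder (a * b) ≠ 0 → n < coxeterOrder (a * b)) :
    0 ≤ dihedralCoeff a b n ∧ 0 ≤ dihedralCoeff a b (n + 1) ∧
      1 ≤ dihedralCoeff a b n + dihedralCoeff a b (n + 1) := by
  by_cases hab : 4 ≤ a * b
  · obtain ⟨h₁, h₂, -⟩ := dihedralCoeff_growth ha hb hab n
    lia
  · have hp : 0 ≤ a * b := mul_nonneg ha hb
    have ha3 : a ≤ 3 := by by_contra!; nlinarith [show 1 ≤ b by grind]
    have hb3 : b ≤ 3 := by by_contra!; nlinarith [show 1 ≤ a by grind]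
    interval_cases a <;> interval_cases b <;>
      first
        | lia
        | simp only [coxeterOrder] at hn
          norm_num at hn
          interval_cases n <;> simp [dihedralCoeff]

namespace KacMoodyRootDatum

variable {ι Λ : Type*} [AddCommGroup Λ] (D : KacMoodyRootDatum ι Λ)

/-- The Weyl group as a Coxeter system. -/
noncomputable abbrev cox : CoxeterSystem D.coxeterMatrix D.WeylGroup :=
  D.coxeterMatrix.toCoxeterSystem

theorem weylAction_simple (k : ι) : D.weylAction (D.cox.simple k) = D.simpleReflection k :=
  D.cox.lift_apply_simple D.simpleReflection_liftable k

theorem weylAction_simple_apply (k : ι) (y : RealCartan Λ) :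
    D.weylAction (D.cox.simple k) y = y - D.root k y • D.coroot k := by
  rw [weylAction_simple, simpleReflection, Module.reflection_apply]

theorem weylAction_mul_apply (v w : D.WeylGroup) (y : RealCartan Λ) :
    D.weylAction (v * w) y = D.weylAction v (D.weylAction w y) := by
  rw [map_mul, LinearEquiv.mul_apply]

theorem weylAction_simple_mul_apply (k : ι) (w : D.WeylGroup) (y : RealCartan Λ) :
    D.weylAction (D.cox.simple k * w) y =
      D.weylAction w y - D.root k (D.weylAction w y) • D.coroot k := by
  rw [weylAction_mul_apply, weylAction_simple_apply]

theorem weylAction_eq_self_of_root_eq_zero {z : RealCartan Λ} (hz : ∀ k, D.root k z = 0)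
    (w : D.WeylGroup) : D.weylAction w z = z := by
  induction w using leftDescent_induction D.cox with
  | one => simp
  | simple_mul k w _ ih => rw [weylAction_simple_mul_apply, ih, hz, zero_smul, sub_zero]

theorem root_weylAction_alternatingWord_add_two (s t : ι) (n : ℕ) (y : RealCartan Λ) :
    D.root s (D.weylAction (D.cox.wordProd (alternatingWord s t (n + 2)))⁻¹ y) =
      -D.A t s * D.root t (D.weylAction (D.cox.wordProd (alternatingWord t s (n + 1)))⁻¹ y) -
        D.root s (D.weylAction (D.cox.wordProd (alternatingWord s t n))⁻¹ y) := by
  rw [inv_wordProd_alternatingWord_succ, weylAction_simple_mul_apply,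
    inv_wordProd_alternatingWord_succ D.cox t s n, weylAction_simple_mul_apply]
  simp only [map_sub, map_smul, smul_eq_mul, root_coroot, D.isGCM.diag]
  push_cast
  ring

theorem root_weylAction_alternatingWord (s t : ι) (n : ℕ) (y : RealCartan Λ) :
    D.root s (D.weylAction (D.cox.wordProd (alternatingWord s t n))⁻¹ y) =
      if Even n then
        dihedralCoeff (-D.A t s) (-D.A s t) (n + 1) * D.root s y +
          dihedralCoeff (-D.A t s) (-D.A s t) n * D.root t y
      else
        dihedralCoeff (-D.A t s) (-D.A s t) n * D.root s y +
          dihedralCoeff (-D.A t s) (-D.A s t) (n + 1) * D.root t y := by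
  induction n using Nat.twoStepInduction generalizing s t with
  | zero => simp [alternatingWord, dihedralCoeff]
  | one =>
    rw [inv_wordProd_alternatingWord_succ, weylAction_simple_mul_apply]
    simp [alternatingWord, dihedralCoeff, root_coroot, sub_eq_add_neg, mul_comm]
  | more n ih₀ ih₁ =>
    rw [root_weylAction_alternatingWord_add_two, ih₀, ih₁]
    by_cases hn : Even n <;>
    · simp only [hn, Nat.even_add_one, dihedralCoeff, if_true, if_false, not_true, not_false_iff]
      push_cast
      ring

theorem dihedralCoeff_cartan_nonneg {s t : ι} (hst : s ≠ t) {n : ℕ}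
    (hn : D.coxeterMatrix s t ≠ 0 → n < D.coxeterMatrix s t) :
    0 ≤ dihedralCoeff (-D.A t s) (-D.A s t) n ∧ 0 ≤ dihedralCoeff (-D.A t s) (-D.A s t) (n + 1) ∧
      1 ≤ dihedralCoeff (-D.A t s) (-D.A s t) n + dihedralCoeff (-D.A t s) (-D.A s t) (n + 1) := by
  refine dihedralCoeff_nonneg (neg_nonneg.2 (D.isGCM.off_diag t s hst.symm))
    (neg_nonneg.2 (D.isGCM.off_diag s t hst)) (by simpa using D.isGCM.zero_iff t s) ?_
  have hM : D.coxeterMatrix s t = coxeterOrder (D.A s t * D.A t s) := if_neg hst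
  rwa [neg_mul_neg, mul_comm, ← hM]

-- The hypothesis `hs` means that `w⁻¹ α_s` is a positive root.
theorem le_root_weylAction {w : D.WeylGroup} {s : ι} (hs : ¬ D.cox.IsLeftDescent w s)
    {y : RealCartan Λ} {ε : ℝ} (hε : 0 ≤ ε) (hy : ∀ k, ε ≤ D.root k y) :
    ε ≤ D.root s (D.weylAction w y) := by
  induction hl : D.cox.length w using Nat.strong_induction_on generalizing w s with
  | _ l ih =>
  obtain rfl | hw := eq_or_ne w 1
  · simpa using hy s
  obtain ⟨t, ht⟩ := D.cox.exists_leftDescent_of_ne_one hw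
  obtain ⟨n, v, hwv, hlen, hvs, hvt⟩ := exists_eq_inv_wordProd_alternatingWord_mul D.cox t hs
  have hn : n ≠ 0 := by
    rintro rfl
    simp only [alternatingWord, D.cox.wordProd_nil, inv_one, one_mul] at hwv
    exact hvt (hwv ▸ ht)
  have hs' := ih _ (by lia) hvs rfl
  have ht' := ih _ (by lia) hvt rfl
  have combination_ge {p q : ℤ} (hp : 0 ≤ p) (hq : 0 ≤ q) (hpq : 1 ≤ p + q) :
      ε ≤ p * D.root s (D.weylAction v y) + q * D.root t (D.weylAction v y) :=
    calc ε ≤ (p + q : ℝ) * ε := le_mul_of_one_le_left hε (by exact_mod_cast hpq)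
      _ = p * ε + q * ε := add_mul _ _ _
      _ ≤ _ := by gcongr
  obtain ⟨h₁, h₂, h₃⟩ := D.dihedralCoeff_cartan_nonneg (by rintro rfl; exact hs ht)
    (lt_of_wordProd_alternatingWord_mul D.cox hs hwv hlen)
  rw [hwv, weylAction_mul_apply, root_weylAction_alternatingWord]
  split_ifs
  · exact combination_ge h₂ h₁ (by rwa [add_comm])
  · exact combination_ge h₁ h₂ h₃

theorem root_weylAction_nonneg {w : D.WeylGroup} {s : ι} (hs : ¬ D.cox.IsLeftDescent w s)
    {y : RealCartan Λ} (hy : ∀ k, 0 ≤ D.root k y) : 0 ≤ D.root s (D.weylAction w y) :=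
  D.le_root_weylAction hs le_rfl hy

/-! ### The dominance order and hulls of orbits -/

/-- The convex cone generated by the simple coroots. It is the cone of non-negative elements of the
dominance order `x ≤ y ↔ y - x ∈ corootCone`. -/
noncomputable def corootCone : PointedCone ℝ (RealCartan Λ) :=
  PointedCone.hull ℝ (Set.range D.coroot)

theorem smul_coroot_mem_corootCone {c : ℝ} (hc : 0 ≤ c) (k : ι) :
    c • D.coroot k ∈ D.corootCone :=
  D.corootCone.smul_mem hc (PointedCone.subset_hull ⟨k, rfl⟩)

theorem mem_corootCone_iff [Fintype ι] {x : RealCartan Λ} :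
    x ∈ D.corootCone ↔ ∃ c : ι → ℝ, (∀ k, 0 ≤ c k) ∧ x = ∑ k, c k • D.coroot k := by
  constructor
  · intro hx
    obtain ⟨c, rfl⟩ := (Submodule.mem_span_range_iff_exists_fun _).1 hx
    exact ⟨fun k => c k, fun k => (c k).2, rfl⟩
  · rintro ⟨c, hc, rfl⟩
    exact sum_mem fun k _ => D.smul_coroot_mem_corootCone (hc k) k

theorem mem_span_of_mem_corootCone {x : RealCartan Λ} (hx : x ∈ D.corootCone) :
    x ∈ Submodule.span ℝ (Set.range D.coroot) :=
  PointedCone.hull_le_span ℝ _ hx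

theorem sub_weylAction_mem_corootCone {y : RealCartan Λ} (hy : ∀ k, 0 ≤ D.root k y)
    (w : D.WeylGroup) : y - D.weylAction w y ∈ D.corootCone := by
  induction w using leftDescent_induction D.cox with
  | one => simp
  | simple_mul k w hk ih =>
    rw [weylAction_simple_mul_apply, sub_sub_eq_add_sub, add_sub_right_comm]
    exact add_mem ih (D.smul_coroot_mem_corootCone (D.root_weylAction_nonneg hk hy) k)

theorem weylAction_mem_orbitHull (h : RealCartan Λ) (w : D.WeylGroup) :
    D.weylAction w h ∈ D.orbitHull h :=
  subset_convexHull ℝ _ ⟨w, rfl⟩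

theorem self_mem_orbitHull (h : RealCartan Λ) : h ∈ D.orbitHull h := by
  simpa using D.weylAction_mem_orbitHull h 1

theorem convex_orbitHull (h : RealCartan Λ) : Convex ℝ (D.orbitHull h) :=
  convex_convexHull ℝ _

theorem weylAction_mem_orbitHull_of_mem {h z : RealCartan Λ} (hz : z ∈ D.orbitHull h)
    (w : D.WeylGroup) : D.weylAction w z ∈ D.orbitHull h := by
  refine convexHull_min (t := {z | D.weylAction w z ∈ D.orbitHull h}) ?_
    ((D.convex_orbitHull h).linear_preimage (D.weylAction w).toLinearMap) hz
  rintro _ ⟨v, rfl⟩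
  rw [Set.mem_ofPred_eq, ← weylAction_mul_apply]
  exact D.weylAction_mem_orbitHull h (w * v)

theorem weylAction_mem_orbitHull_iff {h z : RealCartan Λ} {w : D.WeylGroup} :
    D.weylAction w z ∈ D.orbitHull h ↔ z ∈ D.orbitHull h := by
  refine ⟨fun hz => ?_, fun hz => D.weylAction_mem_orbitHull_of_mem hz w⟩
  simpa using D.weylAction_mem_orbitHull_of_mem hz w⁻¹

theorem orbitHull_subset {h z : RealCartan Λ} (hz : z ∈ D.orbitHull h) :
    D.orbitHull z ⊆ D.orbitHull h := by
  refine convexHull_min ?_ (D.convex_orbitHull h)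
  rintro _ ⟨w, rfl⟩
  exact D.weylAction_mem_orbitHull_of_mem hz w

theorem sub_mem_corootCone_of_mem_orbitHull {h z : RealCartan Λ} (hh : ∀ k, 0 ≤ D.root k h)
    (hz : z ∈ D.orbitHull h) : h - z ∈ D.corootCone := by
  have hconv : Convex ℝ {z | h - z ∈ D.corootCone} := by
    intro x hx y hy a b ha hb hab
    have hsum := add_mem (D.corootCone.smul_mem ha hx) (D.corootCone.smul_mem hb hy)
    rwa [smul_sub, smul_sub, sub_add_sub_comm, ← add_smul, hab, one_smul] at hsum
  refine convexHull_min (t := {z | h - z ∈ D.corootCone}) ?_ hconv hz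
  rintro _ ⟨w, rfl⟩
  exact D.sub_weylAction_mem_corootCone hh w

theorem sub_sum_smul_coroot_mem_orbitHull (p : RealCartan Λ) (s : Finset ι) {c : ι → ℝ}
    (hc : ∀ k ∈ s, 0 ≤ c k) (hc1 : ∑ k ∈ s, c k ≤ 1) :
    p - ∑ k ∈ s, (c k * D.root k p) • D.coroot k ∈ D.orbitHull p := by
  have key := (D.convex_orbitHull p).sum_mem (t := s.insertNone)
    (w := fun o => o.elim (1 - ∑ k ∈ s, c k) c)
    (z := fun o => o.elim p fun k => D.weylAction (D.cox.simple k) p) (fun o ho => ?_)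
    (by simp) (fun o _ => ?_)
  · convert key using 1
    simp only [Finset.sum_insertNone, Option.elim_none, Option.elim_some, weylAction_simple_apply,
      smul_sub, smul_smul, Finset.sum_sub_distrib, ← Finset.sum_smul]
    module
  · cases o with
    | none => simpa using hc1
    | some k => exact hc k (Finset.some_mem_insertNone.1 ho)
  · cases o with
    | none => exact D.self_mem_orbitHull p
    | some k => exact D.weylAction_mem_orbitHull p _

theorem sub_smul_coroot_mem_orbitHull (p : RealCartan Λ) (k : ι) {c : ℝ} (hc : 0 ≤ c)
    (hcp : c ≤ D.root k p) : p - c • D.coroot k ∈ D.orbitHull p := by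
  have hmul : c / D.root k p * D.root k p = c :=
    div_mul_cancel_of_imp fun h0 => le_antisymm (hcp.trans_eq h0) hc
  simpa [hmul] using D.sub_sum_smul_coroot_mem_orbitHull p {k} (c := fun k => c / D.root k p)
    (by simpa using div_nonneg hc (hc.trans hcp))
    (by simpa using div_le_one_of_le₀ hcp (hc.trans hcp))

theorem add_weylAction_mem_orbitHull {a b : RealCartan Λ} (ha : ∀ k, 0 ≤ D.root k a)
    (hb : ∀ k, 0 ≤ D.root k b) (w : D.WeylGroup) :
    a + D.weylAction w b ∈ D.orbitHull (a + b) := by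
  induction w using leftDescent_induction D.cox with
  | one => simpa using D.self_mem_orbitHull (a + b)
  | simple_mul k w hk ih =>
    rw [weylAction_simple_mul_apply, ← add_sub_assoc]
    refine D.orbitHull_subset ih
      (D.sub_smul_coroot_mem_orbitHull _ k (D.root_weylAction_nonneg hk hb) ?_)
    simpa using ha k

open scoped Pointwise in
theorem add_mem_orbitHull {a b x y : RealCartan Λ} (ha : ∀ k, 0 ≤ D.root k a)
    (hb : ∀ k, 0 ≤ D.root k b) (hx : x ∈ D.orbitHull a) (hy : y ∈ D.orbitHull b) :
    x + y ∈ D.orbitHull (a + b) := by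
  have hxy : x + y ∈ D.orbitHull a + D.orbitHull b := Set.add_mem_add hx hy
  rw [orbitHull, orbitHull, ← convexHull_add] at hxy
  refine convexHull_min ?_ (D.convex_orbitHull (a + b)) hxy
  rintro _ ⟨_, ⟨u, rfl⟩, _, ⟨v, rfl⟩, rfl⟩
  have huv := D.weylAction_mem_orbitHull_of_mem (D.add_weylAction_mem_orbitHull ha hb (u⁻¹ * v)) u
  rwa [map_add, ← weylAction_mul_apply, mul_inv_cancel_left] at huv

theorem smul_mem_orbitHull {a x : RealCartan Λ} (c : ℝ) (hx : x ∈ D.orbitHull a) :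
    c • x ∈ D.orbitHull (c • a) := by
  refine convexHull_min (t := {x | c • x ∈ D.orbitHull (c • a)}) ?_
    ((D.convex_orbitHull (c • a)).smul_preimage c) hx
  rintro _ ⟨w, rfl⟩
  rw [Set.mem_ofPred_eq, ← map_smul]
  exact D.weylAction_mem_orbitHull (c • a) w

theorem exists_pos_forall_le_root [Finite ι] {h : RealCartan Λ} (hh : ∀ k, 0 < D.root k h) :
    ∃ ε > 0, ∀ k, ε ≤ D.root k h := by
  cases isEmpty_or_nonempty ι
  · exact ⟨1, one_pos, isEmptyElim⟩
  · obtain ⟨k₀, hk₀⟩ := Finite.exists_min fun k => D.root k h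
    exact ⟨_, hh k₀, hk₀⟩

theorem sub_sum_mem_orbitHull_of_sum_le [Fintype ι] {h : RealCartan Λ} {δ : ℝ} (hδ : 0 < δ)
    (hh : ∀ k, δ ≤ D.root k h) {c : ι → ℝ} (hc : ∀ k, 0 ≤ c k) (hcδ : ∑ k, c k ≤ δ) :
    h - ∑ k, c k • D.coroot k ∈ D.orbitHull h := by
  have hpos (k : ι) : 0 < D.root k h := hδ.trans_le (hh k)
  have key := D.sub_sum_smul_coroot_mem_orbitHull h Finset.univ (c := fun k => c k / D.root k h)
    (fun k _ => div_nonneg (hc k) (hpos k).le) ?_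
  · simpa only [div_mul_cancel₀ _ (hpos _).ne'] using key
  · calc ∑ k, c k / D.root k h ≤ ∑ k, c k / δ :=
          Finset.sum_le_sum fun k _ => div_le_div_of_nonneg_left (hc k) hδ (hh k)
      _ = (∑ k, c k) / δ := (Finset.sum_div _ _ _).symm
      _ ≤ 1 := div_le_one_of_le₀ hcδ hδ.le

-- The segment is traversed in `N` steps, each inside the orbit hull of the point reached so far.
theorem sub_sum_mem_orbitHull_of_sum_le_nsmul [Fintype ι] {δ : ℝ} (hδ : 0 < δ) {c : ι → ℝ}
    (hc : ∀ k, 0 ≤ c k) (N : ℕ) (hcN : ∑ k, c k ≤ N * δ) {h : RealCartan Λ}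
    (hh : ∀ k, δ ≤ D.root k h) (hz : ∀ k, δ ≤ D.root k (h - ∑ k, c k • D.coroot k)) :
    h - ∑ k, c k • D.coroot k ∈ D.orbitHull h := by
  induction N generalizing h c with
  | zero => exact D.sub_sum_mem_orbitHull_of_sum_le hδ hh hc (hcN.trans (by simpa using hδ.le))
  | succ N ih =>
    push_cast at hcN
    set r : ℝ := 1 / (N + 1) with hr
    have hr0 : 0 ≤ r := by positivity
    have hNr : (N + 1) * r = 1 := by rw [hr]; field_simp
    have hr1 : 0 ≤ 1 - r := by nlinarith
    have hsplit : h - ∑ k, c k • D.coroot k =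
        h - (∑ k, (r * c k) • D.coroot k) - ∑ k, ((1 - r) * c k) • D.coroot k := by
      simp only [mul_smul, ← Finset.smul_sum]
      module
    have hp (k : ι) : δ ≤ D.root k (h - ∑ k, (r * c k) • D.coroot k) := by
      have hconv : h - ∑ k, (r * c k) • D.coroot k =
          (1 - r) • h + r • (h - ∑ k, c k • D.coroot k) := by
        simp only [mul_smul, ← Finset.smul_sum]
        module
      rw [hconv, map_add, map_smul, map_smul, smul_eq_mul, smul_eq_mul]
      nlinarith [hh k, hz k]
    rw [hsplit] at hz ⊢
    refine D.orbitHull_subset (D.sub_sum_mem_orbitHull_of_sum_le hδ hh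
      (fun k => mul_nonneg hr0 (hc k)) ?_) (ih (fun k => mul_nonneg hr1 (hc k)) ?_ hp hz)
    · rw [← Finset.mul_sum]
      nlinarith
    · rw [← Finset.mul_sum]
      nlinarith

theorem mem_orbitHull_of_sub_mem_corootCone [Finite ι] {z h : RealCartan Λ}
    (hz : ∀ k, 0 < D.root k z) (hh : ∀ k, 0 < D.root k h) (hzh : h - z ∈ D.corootCone) :
    z ∈ D.orbitHull h := by
  have := Fintype.ofFinite ι
  obtain ⟨c, hc, hsum⟩ := D.mem_corootCone_iff.1 hzh
  obtain ⟨δ₁, hδ₁, hz'⟩ := D.exists_pos_forall_le_root hz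
  obtain ⟨δ₂, hδ₂, hh'⟩ := D.exists_pos_forall_le_root hh
  have hδ : 0 < min δ₁ δ₂ := lt_min hδ₁ hδ₂
  obtain ⟨N, hN⟩ := exists_nat_ge ((∑ k, c k) / min δ₁ δ₂)
  obtain rfl : z = h - ∑ k, c k • D.coroot k := by rw [← hsum, sub_sub_cancel]
  exact D.sub_sum_mem_orbitHull_of_sum_le_nsmul hδ hc N ((div_le_iff₀ hδ).1 hN)
    (fun k => (min_le_right _ _).trans (hh' k)) (fun k => (min_le_left _ _).trans (hz' k))

/-! ### Restriction to standard subgroups -/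

/-- The root datum with the same lattice and with the simple roots and coroots indexed by `J`. Its
Weyl group acts on the real Cartan subalgebra through the standard subgroup `W_J`. -/
def restrict (J : Set ι) : KacMoodyRootDatum J Λ where
  A := fun i j => D.A i j
  isGCM :=
    { diag := fun i => D.isGCM.diag i
      off_diag := fun i j hij => D.isGCM.off_diag i j (Subtype.coe_injective.ne hij)
      zero_iff := fun i j => D.isGCM.zero_iff i j }
  c := fun j => D.c j
  d := fun j => D.d j
  pairing := fun i j => D.pairing i j

theorem restrict_coroot (J : Set ι) (k : J) : (D.restrict J).coroot k = D.coroot k := rfl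

theorem corootCone_restrict_le (J : Set ι) : (D.restrict J).corootCone ≤ D.corootCone :=
  Submodule.span_mono (by rintro _ ⟨k, rfl⟩; exact ⟨k, rfl⟩)

theorem mem_corootCone_restrict_iff [Fintype ι] {J : Set ι} {x : RealCartan Λ} :
    x ∈ (D.restrict J).corootCone ↔
      ∃ c : ι → ℝ, (∀ k, 0 ≤ c k) ∧ (∀ k ∉ J, c k = 0) ∧ x = ∑ k, c k • D.coroot k := by
  classical
  constructor
  · intro hx
    obtain ⟨c, hc, rfl⟩ := (D.restrict J).mem_corootCone_iff.1 hx
    refine ⟨fun k => if hk : k ∈ J then c ⟨k, hk⟩ else 0, fun k => ?_, fun k hk => dif_neg hk, ?_⟩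
    · dsimp only
      split_ifs with hk
      exacts [hc ⟨k, hk⟩, le_rfl]
    · rw [← Fintype.sum_subtype_add_sum_subtype (· ∈ J), Fintype.sum_eq_zero (α := {k // k ∉ J})]
      · simp [restrict_coroot]
      · simp +contextual
  · rintro ⟨c, hc, hJ, rfl⟩
    refine sum_mem fun k _ => ?_
    by_cases hk : k ∈ J
    · exact (D.restrict J).smul_coroot_mem_corootCone (hc k) ⟨k, hk⟩
    · simp [hJ k hk]

theorem range_weylAction :
    D.weylAction.range = Subgroup.closure (Set.range D.simpleReflection) := by
  rw [MonoidHom.range_eq_map, ← D.cox.subgroup_closure_range_simple, MonoidHom.map_closure,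
    ← Set.range_comp]
  exact congrArg (Subgroup.closure ∘ Set.range) (funext D.weylAction_simple)

theorem map_weylAction_standardSubgroup (J : Set ι) :
    (D.standardSubgroup J).map D.weylAction = (D.restrict J).weylAction.range := by
  rw [range_weylAction, standardSubgroup, MonoidHom.map_closure, ← Set.image_comp,
    Set.image_eq_range]
  exact congrArg (Subgroup.closure ∘ Set.range) (funext fun k : J => D.weylAction_simple k)

theorem orbit_eq_setOf_weylAction_restrict (J : Set ι) (y : RealCartan Λ) :
    D.orbit J y = {z | ∃ w, z = (D.restrict J).weylAction w y} := by
  have hmem (g : RealCartan Λ ≃ₗ[ℝ] RealCartan Λ) :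
      (∃ w ∈ D.standardSubgroup J, D.weylAction w = g) ↔ ∃ v, (D.restrict J).weylAction v = g := by
    rw [← MonoidHom.mem_range, ← map_weylAction_standardSubgroup, Subgroup.mem_map]
  ext z
  constructor
  · rintro ⟨w, hw, rfl⟩
    obtain ⟨v, hv⟩ := (hmem _).1 ⟨w, hw, rfl⟩
    exact ⟨v, by rw [hv]⟩
  · rintro ⟨v, rfl⟩
    obtain ⟨w, hw, hwv⟩ := (hmem _).2 ⟨v, rfl⟩
    exact ⟨w, hw, by rw [hwv]⟩

theorem convexHull_orbit (J : Set ι) (y : RealCartan Λ) :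
    convexHull ℝ (D.orbit J y) = (D.restrict J).orbitHull y := by
  rw [orbit_eq_setOf_weylAction_restrict, orbitHull]

theorem orbitHull_restrict_subset (J : Set ι) (y : RealCartan Λ) :
    (D.restrict J).orbitHull y ⊆ D.orbitHull y := by
  rw [← convexHull_orbit]
  exact convexHull_mono fun _ ⟨w, _, hw⟩ => ⟨w, hw⟩

-- The barycentre of a finite orbit is fixed by every simple reflection.
theorem exists_mem_orbitHull_root_eq_zero {h : RealCartan Λ}
    (hfin : {z | ∃ w, z = D.weylAction w h}.Finite) :
    ∃ a ∈ D.orbitHull h, ∀ k, D.root k a = 0 := by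
  have hne : hfin.toFinset.Nonempty := ⟨h, hfin.mem_toFinset.2 ⟨1, by simp⟩⟩
  refine ⟨hfin.toFinset.centerMass (fun _ => (1 : ℝ)) id, ?_, fun k => ?_⟩
  · exact Finset.centerMass_mem_convexHull _ (fun _ _ => zero_le_one) (by simpa using hne)
      fun z hz => hfin.mem_toFinset.1 hz
  · have hmaps : ∀ z ∈ hfin.toFinset, D.weylAction (D.cox.simple k) z ∈ hfin.toFinset := by
      simp only [hfin.mem_toFinset]
      rintro _ ⟨w, rfl⟩
      exact ⟨D.cox.simple k * w, (D.weylAction_mul_apply _ _ _).symm⟩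
    have hinv (z : RealCartan Λ) :
        D.weylAction (D.cox.simple k) (D.weylAction (D.cox.simple k) z) = z := by
      rw [← weylAction_mul_apply, D.cox.simple_mul_simple_self, map_one]
      rfl
    have hsum :
        D.weylAction (D.cox.simple k) (∑ z ∈ hfin.toFinset, z) = ∑ z ∈ hfin.toFinset, z := by
      rw [map_sum]
      exact Finset.sum_nbij' _ _ hmaps hmaps (fun z _ => hinv z) (fun z _ => hinv z) fun _ _ => rfl
    rw [weylAction_simple_apply, sub_eq_self] at hsum
    have hroot := congrArg (D.root k) hsum
    rw [map_smul, root_coroot_self, map_zero, smul_eq_mul] at hroot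
    simp [Finset.centerMass, (mul_eq_zero.1 hroot).resolve_right two_ne_zero]

theorem root_sum_smul_coroot_le [Fintype ι] {c : ι → ℝ} (hc : ∀ k, 0 ≤ c k) (k : ι) :
    D.root k (∑ j, c j • D.coroot j) ≤ c k * 2 := by
  classical
  rw [map_sum, ← D.root_coroot_self k, ← Finset.add_sum_erase _ _ (Finset.mem_univ k), map_smul,
    smul_eq_mul, add_le_iff_nonpos_right]
  refine Finset.sum_nonpos fun j hj => ?_
  rw [map_smul, root_coroot, smul_eq_mul]
  exact mul_nonpos_of_nonneg_of_nonpos (hc j)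
    (by exact_mod_cast D.isGCM.off_diag j k (Finset.ne_of_mem_erase hj))

open Filter Topology in
theorem exists_pos_root_add_smul_pos_and_sub_mem_corootCone [Finite ι] {z h u : RealCartan Λ}
    (hz : ∀ k, 0 ≤ D.root k z) (hh : ∀ k, 0 < D.root k h) (hzh : h - z ∈ D.corootCone)
    (hu : u ∈ (D.restrict {k | D.root k z = 0}).corootCone)
    (hu' : ∀ k, D.root k z = 0 → 0 < D.root k u) :
    ∃ ε : ℝ, 0 < ε ∧ (∀ k, 0 < D.root k (z + ε • u)) ∧ h - (z + ε • u) ∈ D.corootCone := by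
  have := Fintype.ofFinite ι
  obtain ⟨e, -, he, rfl⟩ := D.mem_corootCone_restrict_iff.1 hu
  obtain ⟨c, hc, hsum⟩ := D.mem_corootCone_iff.1 hzh
  set u := ∑ k, e k • D.coroot k with hudef
  have hcpos (k : ι) (hk : D.root k z = 0) : 0 < c k := by
    have hle := D.root_sum_smul_coroot_le hc k
    rw [← hsum, map_sub, hk] at hle
    linarith [hh k]
  have eventually_pos {a : ℝ} (b : ℝ) (ha : 0 < a) : ∀ᶠ ε in 𝓝[>] (0 : ℝ), 0 < a + ε * b := by
    have hcont : Continuous fun ε : ℝ => a + ε * b := by fun_prop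
    exact hcont.continuousWithinAt.eventually (lt_mem_nhds (by simpa))
  have hroot (k : ι) : ∀ᶠ ε in 𝓝[>] (0 : ℝ), 0 < D.root k z + ε * D.root k u := by
    obtain hk | hk := (hz k).eq_or_lt
    · filter_upwards [self_mem_nhdsWithin] with ε hε
      simpa [← hk] using mul_pos hε (hu' k hk.symm)
    · exact eventually_pos _ hk
  have hcoeff (k : ι) : ∀ᶠ ε in 𝓝[>] (0 : ℝ), 0 ≤ c k + ε * -e k := by
    by_cases hk : D.root k z = 0
    · exact (eventually_pos _ (hcpos k hk)).mono fun _ => le_of_lt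
    · simpa [he k hk] using hc k
  obtain ⟨ε, ⟨hε, hε₁⟩, hε₂⟩ := (((eventually_mem_nhdsWithin (s := Set.Ioi (0 : ℝ))).and
    (eventually_all.2 hroot)).and (eventually_all.2 hcoeff)).exists
  refine ⟨ε, hε, fun k => by simpa using hε₁ k, D.mem_corootCone_iff.2 ⟨_, hε₂, ?_⟩⟩
  simp_rw [add_smul, mul_neg, neg_smul, Finset.sum_add_distrib, Finset.sum_neg_distrib, mul_smul,
    ← Finset.smul_sum, ← hsum, ← hudef]
  abel

-- With `a` the barycentre of the finite orbit, `z` lies in the hull of the orbit of the strictly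
-- dominant point `z + ε • (h - a)` under the standard subgroup fixing `z`.
theorem mem_orbitHull_of_finite_orbit [Finite ι] {z h : RealCartan Λ}
    (hz : ∀ k, 0 ≤ D.root k z) (hh : ∀ k, 0 < D.root k h) (hzh : h - z ∈ D.corootCone)
    (hfin : (D.orbit {k | D.root k z = 0} h).Finite) : z ∈ D.orbitHull h := by
  set K := {k | D.root k z = 0}
  rw [orbit_eq_setOf_weylAction_restrict] at hfin
  have hhK (k : K) : 0 ≤ (D.restrict K).root k h := (hh k).le
  obtain ⟨a, ha, haK⟩ := (D.restrict K).exists_mem_orbitHull_root_eq_zero hfin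
  have hha := (D.restrict K).sub_mem_corootCone_of_mem_orbitHull hhK ha
  obtain ⟨ε, hε, hpos, hle⟩ := D.exists_pos_root_add_smul_pos_and_sub_mem_corootCone hz hh hzh hha
    fun k hk => by rw [map_sub, show D.root k a = 0 from haK ⟨k, hk⟩, sub_zero]; exact hh k
  have hza (k : K) : (D.restrict K).root k (z - ε • a) = 0 := by
    rw [map_sub, map_smul, haK, smul_zero, sub_zero]
    exact k.2
  have hzK : z ∈ (D.restrict K).orbitHull (z + ε • (h - a)) := by
    have key := (D.restrict K).add_mem_orbitHull (fun k => (hza k).ge)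
      (fun k => by simpa using mul_nonneg hε.le (hhK k))
      ((D.restrict K).self_mem_orbitHull (z - ε • a)) ((D.restrict K).smul_mem_orbitHull ε ha)
    rwa [sub_add_cancel, sub_add_eq_add_sub, add_sub_assoc, ← smul_sub] at key
  exact D.orbitHull_subset (D.mem_orbitHull_of_sub_mem_corootCone hpos hh hle)
    (D.orbitHull_restrict_subset K _ hzK)

/-! ### Closedness of hulls of orbits -/

theorem weylAction_eq_self_of_mem_standardSubgroup {K : Set ι} {z : RealCartan Λ}
    (hz : ∀ k ∈ K, D.root k z = 0) {w : D.WeylGroup} (hw : w ∈ D.standardSubgroup K) :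
    D.weylAction w z = z := by
  have hmem : D.weylAction w z ∈ D.orbit K z := ⟨w, hw, rfl⟩
  rw [orbit_eq_setOf_weylAction_restrict] at hmem
  obtain ⟨v, hv⟩ := hmem
  rw [hv, (D.restrict K).weylAction_eq_self_of_root_eq_zero fun k => hz k k.2]

theorem nonneg_of_mem_corootCone {ρ : Module.Dual ℝ (RealCartan Λ)}
    (hρ : ∀ k, 0 ≤ ρ (D.coroot k)) {x : RealCartan Λ} (hx : x ∈ D.corootCone) : 0 ≤ ρ x := by
  induction hx using Submodule.span_induction with
  | mem x hx => obtain ⟨k, rfl⟩ := hx; exact hρ k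
  | zero => rw [map_zero]
  | add x y _ _ hx hy => rw [map_add]; exact add_nonneg hx hy
  | smul a x _ hx => exact (map_smul ρ (a : ℝ) x).symm ▸ mul_nonneg a.2 hx

theorem eq_zero_of_mem_corootCone {φ : Module.Dual ℝ (RealCartan Λ)}
    (hφ : ∀ k, φ (D.coroot k) = 0) {x : RealCartan Λ} (hx : x ∈ D.corootCone) : φ x = 0 :=
  le_antisymm
    (neg_nonneg.1 (D.nonneg_of_mem_corootCone (ρ := -φ) (fun k => by simp [hφ k]) hx))
    (D.nonneg_of_mem_corootCone (fun k => (hφ k).ge) hx)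

theorem exists_functional_coroot_eq_one [Finite ι] (hcoroot : LinearIndependent ℝ D.coroot) :
    ∃ ρ : Module.Dual ℝ (RealCartan Λ), ∀ k, ρ (D.coroot k) = 1 := by
  classical
  have := Fintype.ofFinite ι
  obtain ⟨C, hC⟩ := exists_linearMap_apply_eq_single hcoroot
  exact ⟨Fintype.linearCombination ℝ 1 ∘ₗ C, fun k => by simp [hC]⟩

theorem functional_weylAction_add_le {h : RealCartan Λ} {ε : ℝ} (hε : 0 ≤ ε)
    (hh : ∀ k, ε ≤ D.root k h) {ρ : Module.Dual ℝ (RealCartan Λ)} (hρ : ∀ k, ρ (D.coroot k) = 1)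
    (w : D.WeylGroup) : ρ (D.weylAction w h) + ε * D.cox.length w ≤ ρ h := by
  induction w using leftDescent_induction D.cox with
  | one => simp
  | simple_mul k w hk ih =>
    rw [D.cox.not_isLeftDescent_iff.1 hk, weylAction_simple_mul_apply, map_sub, map_smul, hρ,
      smul_eq_mul, mul_one]
    push_cast
    linarith [D.le_root_weylAction hk hε hh]

theorem finite_setOf_le_functional [Finite ι] {h : RealCartan Λ} (hh : ∀ k, 0 < D.root k h)
    {ρ : Module.Dual ℝ (RealCartan Λ)} (hρ : ∀ k, ρ (D.coroot k) = 1) (M : ℝ) :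
    {w | M ≤ ρ (D.weylAction w h)}.Finite := by
  obtain ⟨ε, hε, hεh⟩ := D.exists_pos_forall_le_root hh
  obtain ⟨n, hn⟩ := exists_nat_ge ((ρ h - M) / ε)
  refine (finite_setOf_length_le D.cox n).subset fun w (hw : M ≤ _) => ?_
  have hlen : ε * D.cox.length w ≤ ε * n := by
    rw [div_le_iff₀' hε] at hn
    linarith [D.functional_weylAction_add_le hε.le hεh hρ w]
  exact_mod_cast le_of_mul_le_mul_left hlen hε

theorem exists_forall_root_weylAction_nonneg {y : RealCartan Λ}
    {ρ : Module.Dual ℝ (RealCartan Λ)} (hρ : ∀ k, ρ (D.coroot k) = 1)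
    (hy : ∀ M, {w | M ≤ ρ (D.weylAction w y)}.Finite) :
    ∃ w, ∀ k, 0 ≤ D.root k (D.weylAction w y) := by
  obtain ⟨w, hw, hmax⟩ := Set.exists_max_image _ (fun w => ρ (D.weylAction w y)) (hy (ρ y))
    ⟨1, by simp⟩
  refine ⟨w, fun k => ?_⟩
  by_contra! hk
  have hlt : ρ (D.weylAction w y) < ρ (D.weylAction (D.cox.simple k * w) y) := by
    rw [weylAction_simple_mul_apply, map_sub, map_smul, hρ, smul_eq_mul, mul_one]
    linarith
  exact (hmax _ (hw.trans hlt.le)).not_gt hlt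

theorem mem_orbitHull_of_forall_finite [Finite ι] {y h : RealCartan Λ}
    {ρ : Module.Dual ℝ (RealCartan Λ)} (hρ : ∀ k, ρ (D.coroot k) = 1)
    (hy : ∀ M, {w | M ≤ ρ (D.weylAction w y)}.Finite) (hh : ∀ k, 0 < D.root k h)
    (hyh : ∀ w, h - D.weylAction w y ∈ D.corootCone) : y ∈ D.orbitHull h := by
  obtain ⟨w, hw⟩ := D.exists_forall_root_weylAction_nonneg hρ hy
  refine D.weylAction_mem_orbitHull_iff.1 (D.mem_orbitHull_of_finite_orbit hw hh (hyh w) ?_)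
  refine ((hy (ρ (D.weylAction w y))).image fun v => D.weylAction (v * w⁻¹) h).subset ?_
  rintro _ ⟨g, hg, rfl⟩
  refine ⟨g * w, ?_, by simp⟩
  rw [Set.mem_ofPred_eq, weylAction_mul_apply,
    D.weylAction_eq_self_of_mem_standardSubgroup (fun k hk => hk) hg]

theorem sub_weylAction_mem_span (w : D.WeylGroup) (x : RealCartan Λ) :
    x - D.weylAction w x ∈ Submodule.span ℝ (Set.range D.coroot) := by
  induction w using leftDescent_induction D.cox with
  | one => simp
  | simple_mul k w _ ih =>
    rw [weylAction_simple_mul_apply, sub_sub_eq_add_sub, add_sub_right_comm]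
    exact add_mem ih (Submodule.smul_mem _ _ (Submodule.subset_span ⟨k, rfl⟩))

theorem vectorSpan_setOf_weylAction_le (h : RealCartan Λ) :
    vectorSpan ℝ {z | ∃ w, z = D.weylAction w h} ≤ Submodule.span ℝ (Set.range D.coroot) := by
  have hmem : h ∈ {z | ∃ w, z = D.weylAction w h} := ⟨1, by simp⟩
  rw [vectorSpan_eq_span_vsub_set_left ℝ hmem, Submodule.span_le]
  rintro _ ⟨_, ⟨w, rfl⟩, rfl⟩
  exact D.sub_weylAction_mem_span w h

theorem exists_forall_mem_orbitHull_functional_sub_le [Finite ι] {h : RealCartan Λ}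
    (hh : ∀ k, 0 ≤ D.root k h) {ρ : Module.Dual ℝ (RealCartan Λ)}
    (hρ : ∀ k, ρ (D.coroot k) = 1) :
    ∃ m : ℝ, 0 ≤ m ∧ ∀ x ∈ D.orbitHull h, ∃ w, ∀ v,
      ρ h - ρ (D.weylAction (v * w) h) ≤ m * (ρ h - ρ (D.weylAction v x)) := by
  have hfin : FiniteDimensional ℝ (Submodule.span ℝ (Set.range D.coroot)) :=
    FiniteDimensional.span_of_finite ℝ (Set.finite_range _)
  have := Submodule.finiteDimensional_of_le (D.vectorSpan_setOf_weylAction_le h)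
  refine ⟨finrank ℝ (vectorSpan ℝ {z | ∃ w, z = D.weylAction w h}) + 1, by positivity,
    fun x hx => ?_⟩
  obtain ⟨_, ⟨w, rfl⟩, hw⟩ := exists_mem_sub_apply_le_of_mem_convexHull hx
  refine ⟨w, fun v => ?_⟩
  rw [weylAction_mul_apply]
  refine hw (ρ ∘ₗ (D.weylAction v).toLinearMap) (ρ h) ?_
  rintro _ ⟨u, rfl⟩
  simpa [weylAction_mul_apply] using D.functional_weylAction_add_le le_rfl hh hρ (v * u)

theorem mem_corootCone_iff_forall_nonneg [Finite ι] [DecidableEq ι]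
    {C : RealCartan Λ →ₗ[ℝ] ι → ℝ} (hC : ∀ k, C (D.coroot k) = Pi.single k 1) {x : RealCartan Λ}
    (hx : x ∈ Submodule.span ℝ (Set.range D.coroot)) : x ∈ D.corootCone ↔ ∀ k, 0 ≤ C x k := by
  have := Fintype.ofFinite ι
  obtain ⟨c, rfl⟩ := (Submodule.mem_span_range_iff_exists_fun ℝ).1 hx
  have hCc : C (∑ k, c k • D.coroot k) = c := by
    simp only [map_sum, map_smul, hC]
    exact (pi_eq_sum_univ' c).symm
  refine ⟨fun hcone k => ?_, fun hc => D.mem_corootCone_iff.2 ⟨c, hCc ▸ hc, rfl⟩⟩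
  refine D.nonneg_of_mem_corootCone (ρ := LinearMap.proj k ∘ₗ C) (fun j => ?_) hcone
  simpa [hC, Pi.single_apply] using ite_nonneg zero_le_one le_rfl

-- The point of the right-hand side is that it is a finite union of closed conditions on `x`.
theorem mem_orbitHull_and_le_functional_iff [Finite ι] {h : RealCartan Λ}
    (hh : ∀ k, 0 < D.root k h) {ρ : Module.Dual ℝ (RealCartan Λ)}
    (hρ : ∀ k, ρ (D.coroot k) = 1) (M : ℝ) :
    ∃ m : ℝ, ∃ F : Set D.WeylGroup, F.Finite ∧ ∀ x,
      x ∈ D.orbitHull h ∧ M ≤ ρ x ↔ M ≤ ρ x ∧ (∀ w, h - D.weylAction w x ∈ D.corootCone) ∧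
        ∃ w ∈ F, ∀ v, ρ h - ρ (D.weylAction (v * w) h) ≤ m * (ρ h - ρ (D.weylAction v x)) := by
  obtain ⟨m, hm, hmass⟩ :=
    D.exists_forall_mem_orbitHull_functional_sub_le (fun k => (hh k).le) hρ
  refine ⟨m, {w | ρ h - m * (ρ h - M) ≤ ρ (D.weylAction w h)},
    D.finite_setOf_le_functional hh hρ _, fun x => ⟨?_, ?_⟩⟩
  · rintro ⟨hx, hMx⟩
    obtain ⟨w, hw⟩ := hmass x hx
    refine ⟨hMx, fun v => D.sub_mem_corootCone_of_mem_orbitHull (fun k => (hh k).le)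
      (D.weylAction_mem_orbitHull_of_mem hx v), w, ?_, hw⟩
    have hw1 := hw 1
    rw [one_mul, map_one, LinearEquiv.coe_one, id] at hw1
    rw [Set.mem_ofPred_eq]
    nlinarith
  · rintro ⟨hMx, hcone, w, -, hw⟩
    refine ⟨D.mem_orbitHull_of_forall_finite hρ (fun N => ?_) hh hcone, hMx⟩
    refine ((D.finite_setOf_le_functional hh hρ (ρ h - m * (ρ h - N))).preimage
      (mul_left_injective w).injOn).subset fun v (hv : N ≤ _) => ?_
    rw [Set.mem_preimage, Set.mem_ofPred_eq]
    nlinarith [hw v]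

theorem isClosed_setOf_add_mem_orbitHull [Finite ι] (hcoroot : LinearIndependent ℝ D.coroot)
    {h : RealCartan Λ} (hh : ∀ k, 0 < D.root k h) {ρ : Module.Dual ℝ (RealCartan Λ)}
    (hρ : ∀ k, ρ (D.coroot k) = 1) {p : RealCartan Λ}
    (hp : h - p ∈ Submodule.span ℝ (Set.range D.coroot)) {E : Type*} [NormedAddCommGroup E]
    [NormedSpace ℝ E] [FiniteDimensional ℝ E] {f : E →ₗ[ℝ] RealCartan Λ}
    (hf : ∀ e, f e ∈ Submodule.span ℝ (Set.range D.coroot)) (M : ℝ) :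
    IsClosed {e | p + f e ∈ D.orbitHull h ∧ M ≤ ρ (p + f e)} := by
  classical
  have := Fintype.ofFinite ι
  obtain ⟨C, hC⟩ := exists_linearMap_apply_eq_single hcoroot
  have hspan (w : D.WeylGroup) (e : E) :
      h - D.weylAction w (p + f e) ∈ Submodule.span ℝ (Set.range D.coroot) := by
    convert add_mem (sub_mem hp (hf e)) (D.sub_weylAction_mem_span w (p + f e)) using 1
    abel
  have hcont (g : Module.Dual ℝ (RealCartan Λ)) : Continuous fun e => g (p + f e) := by
    simp only [map_add]
    exact (g ∘ₗ f).continuous_of_finiteDimensional.const_add _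
  have hcont' (v : D.WeylGroup) : Continuous fun e => ρ (D.weylAction v (p + f e)) :=
    hcont (ρ ∘ₗ (D.weylAction v).toLinearMap)
  obtain ⟨m, F, hF, hiff⟩ := D.mem_orbitHull_and_le_functional_iff hh hρ M
  have heq : {e | p + f e ∈ D.orbitHull h ∧ M ≤ ρ (p + f e)} =
      {e | M ≤ ρ (p + f e)} ∩ ((⋂ w, ⋂ k, {e | 0 ≤ C (h - D.weylAction w (p + f e)) k}) ∩
        ⋃ w ∈ F, ⋂ v, {e | ρ h - ρ (D.weylAction (v * w) h) ≤
          m * (ρ h - ρ (D.weylAction v (p + f e)))}) := by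
    ext e
    simp only [Set.mem_ofPred_eq, Set.mem_inter_iff, Set.mem_iInter, Set.mem_iUnion, exists_prop,
      hiff, D.mem_corootCone_iff_forall_nonneg hC (hspan _ _)]
  rw [heq]
  refine (isClosed_le continuous_const (hcont ρ)).inter (IsClosed.inter ?_ ?_)
  · refine isClosed_iInter fun w => isClosed_iInter fun k => isClosed_le continuous_const ?_
    simp only [map_sub, Pi.sub_apply]
    exact continuous_const.sub (hcont (LinearMap.proj k ∘ₗ C ∘ₗ (D.weylAction w).toLinearMap))
  · exact hF.isClosed_biUnion fun w _ => isClosed_iInter fun v =>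
      isClosed_le continuous_const (continuous_const.mul (continuous_const.sub (hcont' v)))

/-! ### Slices and their essential parts -/

theorem convex_openChamber (J : Set ι) : Convex ℝ (D.openChamber J) := by
  simp only [openChamber, Set.ofPred_forall]
  exact convex_iInter₂ fun k _ => convex_halfSpace_gt (D.root k).isLinear 0

theorem exists_weylAction_mem_openChamber [Finite ι] {h : RealCartan Λ}
    (hh : ∀ k, 0 < D.root k h) (J : Set ι) (w : D.WeylGroup) :
    ∃ u ∈ D.standardSubgroup J, D.weylAction (u * w) h ∈ D.openChamber J := by
  obtain ⟨u, hu, hmin⟩ := (measure fun u => D.cox.length (u * w)).wf.has_min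
    (D.standardSubgroup J : Set D.WeylGroup) ⟨1, one_mem _⟩
  refine ⟨u, hu, fun k hk => ?_⟩
  obtain ⟨ε, hε, hεh⟩ := D.exists_pos_forall_le_root hh
  refine hε.trans_le (D.le_root_weylAction (fun hdesc => ?_) hε.le hεh)
  refine hmin (D.cox.simple k * u) (mul_mem (Subgroup.subset_closure ⟨k, hk, rfl⟩) hu) ?_
  rwa [CoxeterSystem.IsLeftDescent, ← mul_assoc] at hdesc

theorem exists_mem_openChamber_mem_orbitHull_restrict [Finite ι] {h : RealCartan Λ}
    (hh : ∀ k, 0 < D.root k h) (J : Set ι) {x : RealCartan Λ} (hx : x ∈ D.orbitHull h) :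
    ∃ p ∈ D.orbitHull h, p ∈ D.openChamber J ∧ x ∈ (D.restrict J).orbitHull p := by
  refine convexHull_min (t := {x | ∃ p ∈ D.orbitHull h, p ∈ D.openChamber J ∧
    x ∈ (D.restrict J).orbitHull p}) ?_ ?_ hx
  · rintro _ ⟨w, rfl⟩
    obtain ⟨u, hu, hC⟩ := D.exists_weylAction_mem_openChamber hh J w
    refine ⟨_, D.weylAction_mem_orbitHull h (u * w), hC, ?_⟩
    rw [← convexHull_orbit]
    exact subset_convexHull ℝ _
      ⟨u⁻¹, inv_mem hu, by rw [← weylAction_mul_apply, inv_mul_cancel_left]⟩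
  · rintro x ⟨p, hp, hpC, hxp⟩ y ⟨q, hq, hqC, hyq⟩ a b ha hb hab
    refine ⟨a • p + b • q, D.convex_orbitHull h hp hq ha hb hab,
      D.convex_openChamber J hpC hqC ha hb hab,
      (D.restrict J).add_mem_orbitHull (fun k => ?_) (fun k => ?_)
        ((D.restrict J).smul_mem_orbitHull a hxp) ((D.restrict J).smul_mem_orbitHull b hyq)⟩
    · rw [map_smul]
      exact mul_nonneg ha (hpC k k.2).le
    · rw [map_smul]
      exact mul_nonneg hb (hqC k k.2).le

theorem mem_levelPlane_iff_of_sub_mem_corootCone {J : Set ι} {φ : Module.Dual ℝ (RealCartan Λ)}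
    (hφ : ∀ k ∈ J, φ (D.coroot k) = 0) {x y : RealCartan Λ}
    (hxy : y - x ∈ (D.restrict J).corootCone) (h : RealCartan Λ) (t : ℝ) :
    x ∈ D.levelPlane h φ t ↔ y ∈ D.levelPlane h φ t := by
  have hspan := D.mem_span_of_mem_corootCone (D.corootCone_restrict_le J hxy)
  have hφxy := (D.restrict J).eq_zero_of_mem_corootCone (fun k => hφ k k.2) hxy
  rw [map_sub, sub_eq_zero] at hφxy
  refine and_congr ?_ (by rw [hφxy])
  rw [orbitSpace, Set.mem_ofPred_eq, Set.mem_ofPred_eq, ← sub_add_sub_cancel y x h]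
  exact (Submodule.add_mem_iff_right _ hspan).symm

theorem convex_slice (h : RealCartan Λ) (φ : Module.Dual ℝ (RealCartan Λ)) (t : ℝ) :
    Convex ℝ (D.slice h φ t) := by
  have horbitSpace : Convex ℝ (D.orbitSpace h) := by
    have hpre := (Submodule.span ℝ (Set.range D.coroot)).convex.translate_preimage_left (-h)
    simp only [← sub_eq_add_neg] at hpre
    exact hpre
  exact (D.convex_orbitHull h).inter (horbitSpace.inter (convex_hyperplane φ.isLinear t))

theorem exists_mem_openChamber_mem_slice [Finite ι] {h : RealCartan Λ}
    (hh : ∀ k, 0 < D.root k h) {J : Set ι} {φ : Module.Dual ℝ (RealCartan Λ)}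
    (hφ : ∀ k ∈ J, φ (D.coroot k) = 0) {t : ℝ} {x : RealCartan Λ} (hx : x ∈ D.slice h φ t) :
    ∃ p ∈ D.slice h φ t, p ∈ D.openChamber J ∧ x ∈ (D.restrict J).orbitHull p := by
  obtain ⟨p, hp, hpC, hxp⟩ := D.exists_mem_openChamber_mem_orbitHull_restrict hh J hx.1
  have hcone := (D.restrict J).sub_mem_corootCone_of_mem_orbitHull (fun k => (hpC k k.2).le) hxp
  exact ⟨p, ⟨hp, (D.mem_levelPlane_iff_of_sub_mem_corootCone hφ hcone h t).1 hx.2⟩, hpC, hxp⟩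

theorem isCompact_setOf_add_mem_orbitHull [Finite ι] (hcoroot : LinearIndependent ℝ D.coroot)
    {h : RealCartan Λ} (hh : ∀ k, 0 < D.root k h) {J : Set ι} [Fintype J] {p : RealCartan Λ}
    (hp : p ∈ D.orbitHull h) :
    IsCompact {c : J → ℝ | 0 ≤ c ∧ p + ∑ k, c k • D.coroot k ∈ D.orbitHull h} := by
  obtain ⟨ρ, hρ⟩ := D.exists_functional_coroot_eq_one hcoroot
  have hle {x : RealCartan Λ} (hx : x ∈ D.orbitHull h) : ρ x ≤ ρ h := by
    rw [← sub_nonneg, ← map_sub]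
    exact D.nonneg_of_mem_corootCone (fun k => (hρ k).symm ▸ zero_le_one)
      (D.sub_mem_corootCone_of_mem_orbitHull (fun k => (hh k).le) hx)
  have hρsum (c : J → ℝ) : ρ (p + ∑ k, c k • D.coroot k) = ρ p + ∑ k, c k := by
    simp [hρ]
  have hclosed := D.isClosed_setOf_add_mem_orbitHull hcoroot hh hρ
    (D.mem_span_of_mem_corootCone (D.sub_mem_corootCone_of_mem_orbitHull (fun k => (hh k).le) hp))
    (f := Fintype.linearCombination ℝ fun k : J => D.coroot k)
    (fun c => sum_mem fun k _ => Submodule.smul_mem _ _ (Submodule.subset_span ⟨k, rfl⟩)) (ρ p)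
  convert (isCompact_Icc (a := 0) (b := fun _ : J => ρ h - ρ p)).inter_right hclosed using 1
  ext c
  simp only [Set.mem_ofPred_eq, Set.mem_inter_iff, Set.mem_Icc, Fintype.linearCombination_apply]
  refine ⟨fun ⟨hc, hmem⟩ => ⟨⟨hc, fun k => ?_⟩, hmem, ?_⟩, fun ⟨hc, hmem⟩ => ⟨hc.1, hmem.1⟩⟩
  · have hck := Finset.single_le_sum (fun k _ => hc k) (Finset.mem_univ k)
    have := hle hmem
    rw [hρsum] at this
    exact hck.trans (by linarith)
  · rw [hρsum]
    exact le_add_of_nonneg_right (Finset.sum_nonneg fun k _ => hc k)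

theorem exists_mem_maximalPoints_orbitHull [Finite ι] (hcoroot : LinearIndependent ℝ D.coroot)
    {h : RealCartan Λ} (hh : ∀ k, 0 < D.root k h) (J : Set ι) {p : RealCartan Λ}
    (hp : p ∈ D.orbitHull h) :
    ∃ y ∈ maximalPoints (D.restrict J).corootCone (D.orbitHull h),
      y - p ∈ (D.restrict J).corootCone := by
  have := Fintype.ofFinite J
  obtain ⟨c, ⟨hc, hcmem⟩, hmax⟩ :=
    (D.isCompact_setOf_add_mem_orbitHull hcoroot hh hp (J := J)).exists_isMaxOn
      (f := fun c => ∑ k, c k) ⟨0, le_rfl, by simpa using hp⟩ (by fun_prop)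
  refine ⟨_, ⟨hcmem, fun y' hy' hcone => ?_⟩,
    (D.restrict J).mem_corootCone_iff.2 ⟨c, hc, add_sub_cancel_left _ _⟩⟩
  obtain ⟨e, he, hsum⟩ := (D.restrict J).mem_corootCone_iff.1 hcone
  rw [sub_eq_iff_eq_add'] at hsum
  simp only [restrict_coroot] at hsum
  have hle := hmax (show c + e ∈ _ from ⟨add_nonneg hc he, by
    simpa [add_smul, Finset.sum_add_distrib, ← add_assoc, hsum] using hy'⟩)
  simp only [Pi.add_apply, Finset.sum_add_distrib, Set.mem_ofPred_eq] at hle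
  have hzero := (Fintype.sum_eq_zero_iff_of_nonneg he).1
    ((add_le_iff_nonpos_right _).1 hle |>.antisymm (Finset.sum_nonneg fun k _ => he k))
  simp [hsum, hzero]

theorem maximalPoints_slice_subset_openChamber [Finite ι] {h : RealCartan Λ}
    (hh : ∀ k, 0 < D.root k h) {J : Set ι} {φ : Module.Dual ℝ (RealCartan Λ)}
    (hφ : ∀ k ∈ J, φ (D.coroot k) = 0) (t : ℝ) :
    maximalPoints (D.restrict J).corootCone (D.slice h φ t) ⊆ D.openChamber J := by
  rintro y ⟨hy, hmax⟩
  obtain ⟨p, hp, hpC, hyp⟩ := D.exists_mem_openChamber_mem_slice hh hφ hy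
  exact hmax p hp ((D.restrict J).sub_mem_corootCone_of_mem_orbitHull
    (fun k => (hpC k k.2).le) hyp) ▸ hpC

theorem maximalPoints_slice_subset_essentialPart [Finite ι] {h : RealCartan Λ}
    (hh : ∀ k, 0 < D.root k h) {J : Set ι} {φ : Module.Dual ℝ (RealCartan Λ)}
    (hφ : ∀ k ∈ J, φ (D.coroot k) = 0) (t : ℝ) :
    maximalPoints (D.restrict J).corootCone (D.slice h φ t) ⊆
      D.essentialPart J (D.slice h φ t) := fun y hy =>
  have hconv := D.convex_slice h φ t
  ⟨minimalFace (D.slice h φ t) y, isFace_minimalFace hconv hy.1,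
    (minimalFace_subset_of_isExtreme (isExtreme_maximalPoints hconv _) hy).trans
      (D.maximalPoints_slice_subset_openChamber hh hφ t), mem_minimalFace_self hy.1⟩

theorem exists_mem_essentialPart_mem_orbitHull_restrict [Finite ι]
    (hcoroot : LinearIndependent ℝ D.coroot) {h : RealCartan Λ} (hh : ∀ k, 0 < D.root k h)
    {J : Set ι} {φ : Module.Dual ℝ (RealCartan Λ)} (hφ : ∀ k ∈ J, φ (D.coroot k) = 0) {t : ℝ}
    {x : RealCartan Λ} (hx : x ∈ D.slice h φ t) :
    ∃ y ∈ D.essentialPart J (D.slice h φ t), x ∈ (D.restrict J).orbitHull y := by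
  obtain ⟨p, hp, hpC, hxp⟩ := D.exists_mem_openChamber_mem_slice hh hφ hx
  obtain ⟨y, ⟨hy, hmax⟩, hpy⟩ := D.exists_mem_maximalPoints_orbitHull hcoroot hh J hp.1
  have hyslice : y ∈ D.slice h φ t :=
    ⟨hy, (D.mem_levelPlane_iff_of_sub_mem_corootCone hφ hpy h t).1 hp.2⟩
  have hymax : y ∈ maximalPoints (D.restrict J).corootCone (D.slice h φ t) :=
    ⟨hyslice, fun z hz => hmax z hz.1⟩
  have hyC := D.maximalPoints_slice_subset_openChamber hh hφ t hymax
  exact ⟨y, D.maximalPoints_slice_subset_essentialPart hh hφ t hymax,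
    (D.restrict J).orbitHull_subset ((D.restrict J).mem_orbitHull_of_sub_mem_corootCone
      (fun k => hpC k k.2) (fun k => hyC k k.2) hpy) hxp⟩

theorem orbitHull_restrict_subset_slice {h y : RealCartan Λ} {J : Set ι}
    {φ : Module.Dual ℝ (RealCartan Λ)} (hφ : ∀ k ∈ J, φ (D.coroot k) = 0) {t : ℝ}
    (hy : y ∈ D.slice h φ t) (hyC : y ∈ D.openChamber J) :
    (D.restrict J).orbitHull y ⊆ D.slice h φ t := fun _ hx =>
  ⟨D.orbitHull_subset hy.1 (D.orbitHull_restrict_subset J y hx),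
    (D.mem_levelPlane_iff_of_sub_mem_corootCone hφ
      ((D.restrict J).sub_mem_corootCone_of_mem_orbitHull (fun k => (hyC k k.2).le) hx) h t).2 hy.2⟩

end KacMoodyRootDatum

theorem mainTheorem7_general {ι Λ : Type*} [Finite ι] [AddCommGroup Λ] (D : KacMoodyRootDatum ι Λ)
    (hcoroot : LinearIndependent ℝ D.coroot) {h : RealCartan Λ} (hh : ∀ k, 0 < D.root k h)
    (J : Set ι) {φ : Module.Dual ℝ (RealCartan Λ)} (hφ : ∀ k ∈ J, φ (D.coroot k) = 0) (t : ℝ) :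
    D.slice h φ t =
      ⋃ y ∈ D.essentialPart J (D.slice h φ t), convexHull ℝ (D.orbit J y) := by
  simp only [D.convexHull_orbit]
  refine Set.Subset.antisymm (fun x hx => ?_) (Set.iUnion₂_subset ?_)
  · obtain ⟨y, hy, hxy⟩ := D.exists_mem_essentialPart_mem_orbitHull_restrict hcoroot hh hφ hx
    exact Set.mem_biUnion hy hxy
  · rintro y ⟨F, hF, hFC, hyF⟩
    exact D.orbitHull_restrict_subset_slice hφ (hF.2.2.subset hyF) (hFC hyF)

theorem mainTheorem7 {ι Λ κ : Type*} [Fintype ι] [DecidableEq ι] [AddCommGroup Λ]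
    [Module.Free ℤ Λ] [Module.Finite ℤ Λ] (D : KacMoodyRootDatum ι Λ)
    (hsymm : IsSymmetrizable D.A) (hfree : D.IsFree) (hcofree : D.IsCofree)
    (b : Module.Basis (ι ⊕ κ) ℝ (RealCartan Λ)) (hb : ∀ j, b (Sum.inl j) = D.coroot j)
    (h : RealCartan Λ) (hh : h ∈ D.openChamber Set.univ) (i : ι) (t : ℝ) :
    D.slice h (b.coord (Sum.inl i)) t =
      ⋃ y ∈ D.essentialPart {i}ᶜ (D.slice h (b.coord (Sum.inl i)) t),
        convexHull ℝ (D.orbit {i}ᶜ y) :=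
  mainTheorem7_general D
    (by
      rw [← show b ∘ Sum.inl = D.coroot from funext hb]
      exact b.linearIndependent.comp Sum.inl Sum.inl_injective)
    (fun k => hh k (Set.mem_univ k)) _
    (fun k hk => by
      rw [← hb, Module.Basis.coord_apply, Module.Basis.repr_self,
        Finsupp.single_eq_of_ne fun hik => hk (Sum.inl_injective hik).symm]) t
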